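/- A qualgebra is a set $Q$ with two binary operations $\lhd$ and $\diamond$ such that $(Q,\lhd)$ is a quandle, that is, $(a\lhd b)\lhd c=(a\lhd c)\lhd(b\lhd c)$, every map $a\mapsto a\lhd b$ is a bijection, $a\lhd a=a$, and such that $a\lhd(b\diamond c)=(a\lhd b)\lhd c$, $(a\diamond b)\lhd c=(a\lhd c)\diamond(b\lhd c)$ and $a\diamond b=b\diamond(a\lhd b)$ for all $a,b,c\in Q$. A diagram of a knotted oriented $3$-valent graph is well-oriented if each of its vertices is a zip vertex (two arcs come in, one goes out) or an unzip vertex (one arc comes in, two go out); its arcs are the parts delimited by crossing points and vertices. A $Q$-coloring of a well-oriented (sub-)diagram assigns an element of $Q$ to every arc such that: at a crossing point, both over-arcs have the same color $b$, and if the under-arc on the right of the over-strand has color $a$, then the under-arc on its left has color $a\lhd b$; at a vertex, drawn with all arcs directed downwards, if the two arcs on the same side (the upper ones for a zip vertex, the lower ones for an unzip vertex) have colors $a$ (left) and $b$ (right), then the third arc has color $a\diamond b$. Given maps $\chi,\lambda:Q\times Q\to\mathbb{Z}$, let $(\chi,\lambda)$ be the weight function which, with $a,b$ as above, takes the value $\chi(a,b)$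 at a positive crossing point (the under-strand passes from the right to the left of the over-strand), $-\chi(a,b)$ at a negative one, $\lambda(a,b)$ at an unzip vertex, and $-\lambda(a,b)$ at a zip vertex. The weight of a colored (sub-)diagram is the sum of the values at its special points. The R-moves are the six Reidemeister moves $\mathrm{RI}$-$\mathrm{RVI}$ for knotted $3$-valent graph diagrams: the moves $\mathrm{RI}$-$\mathrm{RIII}$ for knots, passing a strand under ($\mathrm{RIV}$) or over ($\mathrm{RVI}$) a vertex, and removing a crossing between two legs next to a vertex ($\mathrm{RV}$); they are considered up to planar isotopy and reflection, with all possible well-orientations of the strands. The weight function is called Boltzmann if for every R-move and every pair of $Q$-colorings of the two sub-diagrams involved that coincide on the boundary of the small disc where the move takes place, the two weights are equal. Proposition. Let $(Q,\lhd,\diamond)$ be a qualgebra and let $\chi,\lambda:Q\times Q\to\mathbb{Z}$ be two maps. The weight function $(\chi,\lambda)$ is Boltzmann if and only if $\chi$ is a quandle $2$-cocycle, i.e., for all $a,b,c\in Q$, $$\chi(a,b)+\chi(a\lhd b,c)=\chi(a\lhd c,b\lhd c)+\chi(a,c),\qquad \chi(a,a)=0,$$ and moreover, for all $a,b,c\in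 Q$, $$\chi(a,b\diamond c)=\chi(a,b)+\chi(a\lhd b,c),$$ $$\chi(a\diamond b,c)+\lambda(a\lhd c,b\lhd c)=\chi(a,c)+\chi(b,c)+\lambda(a,b),$$ $$\chi(a,b)+\lambda(a,b)=\lambda(b,a\lhd b).$$ -/

import Mathlib

/-- The right-handed quandle operation `a ◁ b` ("`b` acts on `a`") in terms of Mathlib's
left-handed one, in which `b ◃ a` denotes the action of `b` on `a`. -/
notation:70 a:70 " ◁ " b:71 => Shelf.act b a

/-- A qualgebra: a quandle with a second binary operation `⋄` satisfying translation composability,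
distributivity and semi-commutativity. -/
class Qualgebra (Q : Type*) extends Quandle Q where
  /-- the operation `⋄` -/
  dia : Q → Q → Q
  comp : ∀ a b c : Q, a ◁ (dia b c) = (a ◁ b) ◁ c
  distrib : ∀ a b c : Q, (dia a b) ◁ c = dia (a ◁ c) (b ◁ c)
  semicomm : ∀ a b : Q, dia a b = dia b (a ◁ b)

infixl:70 " ⋄ " => Qualgebra.dia

namespace KnottedGraph

/-- The four oriented type patterns around the special points of a well-oriented `3`-valent graph
diagram, with the arcs around the point labelled by elements of `X` (names of arcs, or colors).
* `posCrossing`: a positive crossing point; the under-strand runs from `underIn` to `underOut`, the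
  over-strand from `overIn` to `overOut`, and the under-strand passes from the right-hand side to
  the left-hand side of the over-strand.
* `negCrossing`: same, with the under-strand passing from the left-hand side to the right-hand side
  of the over-strand.
* `zip`: two arcs come in and one goes out; with all arcs running downwards, `left` and `right` are
  the upper left and upper right arcs, and `stem` is the lower arc.
* `unzip`: one arc comes in and two go out; with all arcs running downwards, `stem` is the upper
  arc, and `left` and `right` are the lower left and lower right arcs. -/
inductive Pattern (X : Type*) where
  | posCrossing (underIn overIn overOut underOut : X)
  | negCrossing (underIn overIn overOut underOut : X)
  | zip (left right stem : X)
  | unzip (stem left right : X)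

/-- Relabelling of a pattern; for a coloring `C` of arcs, `P.map C` is the colored pattern. -/
def Pattern.map {X Y : Type*} (C : X → Y) : Pattern X → Pattern Y
  | .posCrossing a b c d => .posCrossing (C a) (C b) (C c) (C d)
  | .negCrossing a b c d => .negCrossing (C a) (C b) (C c) (C d)
  | .zip a b c => .zip (C a) (C b) (C c)
  | .unzip a b c => .unzip (C a) (C b) (C c)

/-- The qualgebra coloring rules. Around a crossing point, the color of the over-strand does not
change, and if it is `b`, then the under-arc to the right of the over-strand has some color `a` and
the under-arc to the left has color `a ◁ b`. Around a vertex, the stem has color `a ⋄ b`. -/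
def Pattern.IsColored {Q : Type*} [Qualgebra Q] : Pattern Q → Prop
  | .posCrossing underIn overIn overOut underOut =>
      overOut = overIn ∧ underOut = underIn ◁ overIn
  | .negCrossing underIn overIn overOut underOut =>
      overOut = overIn ∧ underIn = underOut ◁ overIn
  | .zip left right stem => stem = left ⋄ right
  | .unzip stem left right => stem = left ⋄ right

/-- The weight function given by two maps `χ` and `lam`. -/
def pairWeight {Q : Type*} (χ lam : Q → Q → ℤ) : Pattern Q → ℤ
  | .posCrossing underIn overIn _ _ => χ underIn overIn
  | .negCrossing _ overIn _ underOut => -χ underOut overIn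
  | .zip left right _ => -lam left right
  | .unzip _ left right => lam left right

/-- An end of an arc: the arc, together with a label telling its two ends apart. -/
abbrev ArcEnd (A : Type*) := A × Bool

/-- An unoriented special point, given by the arc ends meeting there in counter-clockwise order.
At a crossing point, the ends `u₀`, `u₂` belong to the under-strand and `o₁`, `o₃` to the
over-strand. -/
inductive SpecialPoint (A : Type*) where
  | crossing (u₀ o₁ u₂ o₃ : ArcEnd A)
  | vertex (e₀ e₁ e₂ : ArcEnd A)

/-- The arc ends meeting at a special point. -/
def SpecialPoint.ends {A : Type*} : SpecialPoint A → List (ArcEnd A)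
  | .crossing u₀ o₁ u₂ o₃ => [u₀, o₁, u₂, o₃]
  | .vertex e₀ e₁ e₂ => [e₀, e₁, e₂]

/-- Reflection of the plane: the cyclic order of the ends is reversed. -/
def SpecialPoint.mirror {A : Type*} : SpecialPoint A → SpecialPoint A
  | .crossing u₀ o₁ u₂ o₃ => .crossing u₀ o₃ u₂ o₁
  | .vertex e₀ e₁ e₂ => .vertex e₀ e₂ e₁

/-- For an orientation `o`, where `o α` is the label of the end of `α` towards which the arc `α` is
directed: whether `α` is directed towards the given end. -/
def IsHead {A : Type*} (o : A → Bool) (e : ArcEnd A) : Bool := o e.1 == e.2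

/-- The oriented pattern around a special point when the arcs are oriented by `o`. It is undefined
if the orientations of the two halves of a strand through a crossing point do not match, or if a
vertex is a source or a sink. -/
def SpecialPoint.orient {A : Type*} (o : A → Bool) : SpecialPoint A → Option (Pattern A)
  | .crossing u₀ o₁ u₂ o₃ =>
      match IsHead o u₀, IsHead o o₁, IsHead o u₂, IsHead o o₃ with
      | true, false, false, true => some (.posCrossing u₀.1 o₃.1 o₁.1 u₂.1)
      | false, true, true, false => some (.posCrossing u₂.1 o₁.1 o₃.1 u₀.1)
      | true, true, false, false => some (.negCrossing u₀.1 o₁.1 o₃.1 u₂.1)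
      | false, false, true, true => some (.negCrossing u₂.1 o₃.1 o₁.1 u₀.1)
      | _, _, _, _ => none
  | .vertex e₀ e₁ e₂ =>
      match IsHead o e₀, IsHead o e₁, IsHead o e₂ with
      | false, true, true => some (.zip e₂.1 e₁.1 e₀.1)
      | true, false, true => some (.zip e₀.1 e₂.1 e₁.1)
      | true, true, false => some (.zip e₁.1 e₀.1 e₂.1)
      | true, false, false => some (.unzip e₀.1 e₁.1 e₂.1)
      | false, true, false => some (.unzip e₁.1 e₂.1 e₀.1)
      | false, false, true => some (.unzip e₂.1 e₀.1 e₁.1)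
      | _, _, _ => none

/-- An unoriented sub-diagram with `n` arcs inside a disc, encoded combinatorially: its arcs (the
parts delimited by special points and by the boundary of the disc) are numbered; the data are its special points, and the list of the arc ends
lying on the boundary of the disc. Every end of every arc lies either at exactly one place of
exactly one special point, or at exactly one place of the boundary. -/
structure SubDiagram (n : ℕ) where
  points : List (SpecialPoint (Fin n))
  boundary : List (ArcEnd (Fin n))
  ends_once : ∀ e : ArcEnd (Fin n),
    (points.flatMap SpecialPoint.ends ++ boundary).count e = 1

namespace SubDiagram

theorem ends_mirror {A : Type*} (l : List (SpecialPoint A)) :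
    ((l.map SpecialPoint.mirror).flatMap SpecialPoint.ends).Perm
      (l.flatMap SpecialPoint.ends) := by
  induction l with
  | nil => exact List.Perm.refl _
  | cons p l ih =>
    simp only [List.map_cons, List.flatMap_cons]
    refine List.Perm.append ?_ ih
    cases p with
    | crossing u₀ o₁ u₂ o₃ =>
      exact List.Perm.cons _ ((List.reverse_perm [o₁, u₂, o₃]))
    | vertex e₀ e₁ e₂ => exact List.Perm.cons _ ((List.reverse_perm [e₁, e₂]))

/-- The image of a sub-diagram under a reflection of the plane. -/
def mirror {n : ℕ} (D : SubDiagram n) : SubDiagram n where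
  points := D.points.map SpecialPoint.mirror
  boundary := D.boundary
  ends_once e := by
    rw [((ends_mirror D.points).append_right D.boundary).count_eq]
    exact D.ends_once e

/-- The orientation `o` of the arcs turns `D` into a well-oriented sub-diagram: strands are oriented
coherently through crossing points, and there are only zip and unzip vertices. -/
def WellOriented {n : ℕ} (D : SubDiagram n) (o : Fin n → Bool) : Prop :=
  ∀ p ∈ D.points, (p.orient o).isSome

/-- The oriented patterns around the special points of an oriented sub-diagram. -/
def patterns {n : ℕ} (D : SubDiagram n) (o : Fin n → Bool) : List (Pattern (Fin n)) :=
  D.points.filterMap (SpecialPoint.orient o)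

/-- `C` is a coloring of the oriented sub-diagram. -/
def IsColoring {n : ℕ} {Q : Type*} [Qualgebra Q] (D : SubDiagram n) (o : Fin n → Bool) (C : Fin n → Q) :
    Prop :=
  ∀ P ∈ D.patterns o, (P.map C).IsColored

/-- The weight of a colored sub-diagram: the sum of the weights of its special points. -/
def weight {n : ℕ} {Q : Type*} (ω : Pattern Q → ℤ) (D : SubDiagram n) (o : Fin n → Bool) (C : Fin n → Q) :
    ℤ :=
  ((D.patterns o).map fun P => ω (P.map C)).sum

/-- What a colored oriented sub-diagram looks like on the boundary of the disc: for every boundary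
point, whether the arc there leaves the disc, and its color. -/
def boundaryData {n : ℕ} {Q : Type*} (D : SubDiagram n) (o : Fin n → Bool) (C : Fin n → Q) :
    List (Bool × Q) :=
  D.boundary.map fun e => (IsHead o e, C e.1)

/-! The two sides of the six moves. In the pictures described below, the label `false` marks the
upper end of an arc and `true` its lower end (for the loop in the first move, `false` marks the end
that is met first when the strand is followed from top to bottom); boundary points are listed
counter-clockwise, starting from the top right (in the first move, from top to bottom). -/

/-- A kink: a strand runs from the top downwards to the right, turns back over a loop and crosses
over itself. -/
def kink : SubDiagram 3 where
  points := [.crossing (0, true) (2, false) (1, false) (1, true)]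
  boundary := [(0, false), (2, true)]
  ends_once := by decide

/-- One vertical strand. -/
def strand : SubDiagram 1 where
  points := []
  boundary := [(0, false), (0, true)]
  ends_once := by decide

/-- Two strands crossing twice: the over-strand (arcs 3, 4, 5) starts and ends on the left, the
under-strand (arcs 0, 1, 2) on the right. -/
def bigon : SubDiagram 6 where
  points :=
    [.crossing (0, true) (3, true) (1, false) (4, false),
     .crossing (1, true) (5, false) (2, false) (4, true)]
  boundary := [(0, false), (3, false), (5, true), (2, true)]
  ends_once := by decide

/-- Two vertical strands: arc 1 on the left and arc 0 on the right. -/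
def twoStrands : SubDiagram 2 where
  points := []
  boundary := [(0, false), (1, false), (1, true), (0, true)]
  ends_once := by decide

/-- Three strands: the lowest one (arcs 0, 1, 2) runs from the top left to the bottom right, the
intermediate one (arcs 3, 4, 5) is vertical, the highest one (arcs 6, 7, 8) runs from the top right
to the bottom left. Here the vertical strand passes to the left of the crossing point of the two
other ones. -/
def triangle : SubDiagram 9 where
  points :=
    [.crossing (0, true) (4, false) (1, false) (3, true),
     .crossing (1, true) (7, false) (2, false) (6, true),
     .crossing (4, true) (8, false) (5, false) (7, true)]
  boundary := [(6, false), (3, false), (0, false), (8, true), (5, true), (2, true)]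
  ends_once := by decide

/-- The same three strands; the vertical one passes to the right of the crossing point of the two
other ones. -/
def triangle' : SubDiagram 9 where
  points :=
    [.crossing (3, true) (7, false) (4, false) (6, true),
     .crossing (0, true) (8, false) (1, false) (7, true),
     .crossing (1, true) (5, false) (2, false) (4, true)]
  boundary := [(6, false), (3, false), (0, false), (8, true), (5, true), (2, true)]
  ends_once := by decide

/-- A vertex with two legs going up (to the top middle: arc 2, to the top right: arc 3) and one leg
going to the bottom left (arcs 4, 5), and a strand from the top left to the bottom right (arcs 0, 1)
passing below the vertex in the picture, and under the lower leg. -/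
def underOneLeg : SubDiagram 6 where
  points :=
    [.vertex (4, false) (3, true) (2, true),
     .crossing (0, true) (5, false) (1, false) (4, true)]
  boundary := [(3, false), (2, false), (0, false), (5, true), (1, true)]
  ends_once := by decide

/-- The same vertex and strand; now the strand (arcs 0, 1, 2) passes above the vertex in the
picture, first under the middle leg (arcs 3, 4) and then under the right leg (arcs 5, 6). -/
def underTwoLegs : SubDiagram 8 where
  points :=
    [.crossing (0, true) (4, false) (1, false) (3, true),
     .crossing (1, true) (6, false) (2, false) (5, true),
     .vertex (7, false) (6, true) (4, true)]
  boundary := [(5, false), (3, false), (0, false), (7, true), (2, true)]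
  ends_once := by decide

/-- A vertex with two legs going up and one (arc 4) going down, where the upper legs cross: the one
from the top left (arcs 0, 1) passes under the one from the top right (arcs 2, 3). -/
def twistedVertex : SubDiagram 5 where
  points :=
    [.crossing (0, true) (3, false) (1, false) (2, true),
     .vertex (4, false) (1, true) (3, true)]
  boundary := [(2, false), (0, false), (4, true)]
  ends_once := by decide

/-- A vertex with two legs going up (left: arc 0, right: arc 1) and one (arc 2) going down. -/
def plainVertex : SubDiagram 3 where
  points := [.vertex (2, false) (1, true) (0, true)]
  boundary := [(1, false), (0, false), (2, true)]
  ends_once := by decide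

/-- A vertex with two legs going up (to the top left: arc 2, to the top middle: arc 3) and one leg
going to the bottom right (arcs 4, 5), and a strand from the top right to the bottom left (arcs
0, 1) passing below the vertex in the picture, and over the lower leg. -/
def overOneLeg : SubDiagram 6 where
  points :=
    [.vertex (4, false) (3, true) (2, true),
     .crossing (4, true) (1, false) (5, false) (0, true)]
  boundary := [(0, false), (3, false), (2, false), (1, true), (5, true)]
  ends_once := by decide

/-- The same vertex and strand; now the strand (arcs 0, 1, 2) passes above the vertex in the
picture, first over the middle leg (arcs 3, 4) and then over the left leg (arcs 5, 6). -/
def overTwoLegs : SubDiagram 8 where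
  points :=
    [.crossing (3, true) (1, false) (4, false) (0, true),
     .crossing (5, true) (2, false) (6, false) (1, true),
     .vertex (7, false) (4, true) (6, true)]
  boundary := [(0, false), (3, false), (5, false), (2, true), (7, true)]
  ends_once := by decide

end SubDiagram

open SubDiagram in
/-- The unoriented Reidemeister moves for knotted `3`-valent graph diagrams, up to a reflection of
the plane. Corresponding boundary points are listed in the same order on the two sides. -/
inductive RMove : {n m : ℕ} → SubDiagram n → SubDiagram m → Prop
  | r1 : RMove kink strand
  | r2 : RMove bigon twoStrands
  | r3 : RMove triangle triangle'
  | r4 : RMove underOneLeg underTwoLegs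
  | r5 : RMove twistedVertex plainVertex
  | r6 : RMove overOneLeg overTwoLegs
  | mirror {n m : ℕ} {D : SubDiagram n} {D' : SubDiagram m} : RMove D D' → RMove D.mirror D'.mirror

/-- A weight function is Boltzmann if, for every R-move with every well-orientation of the strands,
the weights of any two correspondingly colored sub-diagrams coincide. -/
def IsBoltzmann {Q : Type*} [Qualgebra Q] (ω : Pattern Q → ℤ) : Prop :=
  ∀ (n m : ℕ) (D : SubDiagram n) (D' : SubDiagram m), RMove D D' →
    ∀ (o : Fin n → Bool) (o' : Fin m → Bool), D.WellOriented o → D'.WellOriented o' →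
      ∀ (C : Fin n → Q) (C' : Fin m → Q), D.IsColoring o C → D'.IsColoring o' C' →
        D.boundaryData o C = D'.boundaryData o' C' →
          D.weight ω o C = D'.weight ω o' C'

end KnottedGraph

namespace KnottedGraph

/-! Each identity is the weight equation of one move with every arc directed downwards: RI gives `χ
a a = 0`, RIII the cocycle identity, RIV and RVI the two relations for `χ` and `⋄`, RV the last one.
RII imposes nothing, since its two crossings have opposite signs. Necessity needs only this one
orientation and one explicit coloring per move. Sufficiency must treat every orientation and the
mirror images. There the qualgebra axioms match the colors, and the weight equation is the same
identity rearranged, except that some orientations of RV combine several identities.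
`RMove.sameWeight` collects these cases. -/

theorem SpecialPoint.orient_crossing_isSome {A : Type*} (o : A → Bool) (u₀ o₁ u₂ o₃ : ArcEnd A) :
    ((SpecialPoint.crossing u₀ o₁ u₂ o₃).orient o).isSome ↔
      IsHead o u₂ = !IsHead o u₀ ∧ IsHead o o₃ = !IsHead o o₁ := by
  simp only [orient]
  cases IsHead o u₀ <;> cases IsHead o o₁ <;> cases IsHead o u₂ <;> cases IsHead o o₃ <;> simp

theorem SpecialPoint.orient_vertex_isSome {A : Type*} (o : A → Bool) (e₀ e₁ e₂ : ArcEnd A) :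
    ((SpecialPoint.vertex e₀ e₁ e₂).orient o).isSome ↔
      ¬(IsHead o e₀ = IsHead o e₁ ∧ IsHead o e₁ = IsHead o e₂) := by
  simp only [orient]
  cases IsHead o e₀ <;> cases IsHead o e₁ <;> cases IsHead o e₂ <;> simp

/-- The weights of correspondingly colored diagrams coincide. -/
def SameWeight {Q : Type*} [Qualgebra Q] (ω : Pattern Q → ℤ) {n m : ℕ}
    (D : SubDiagram n) (D' : SubDiagram m) : Prop :=
  ∀ (o : Fin n → Bool) (o' : Fin m → Bool), D.WellOriented o → D'.WellOriented o' →
    ∀ (C : Fin n → Q) (C' : Fin m → Q), D.IsColoring o C → D'.IsColoring o' C' →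
      D.boundaryData o C = D'.boundaryData o' C' → D.weight ω o C = D'.weight ω o' C'

theorem SubDiagram.mirror_mirror {n : ℕ} (D : SubDiagram n) : D.mirror.mirror = D := by
  obtain ⟨p, b, h⟩ := D
  have : SpecialPoint.mirror ∘ SpecialPoint.mirror = @id (SpecialPoint (Fin n)) := by
    funext x; cases x <;> rfl
  simp [SubDiagram.mirror, this]

theorem quandle_fix {Q : Type*} [Qualgebra Q] (a : Q) : a ◁ a = a := Quandle.fix

theorem act_act {Q : Type*} [Qualgebra Q] (a b c : Q) : (a ◁ b) ◁ c = (a ◁ c) ◁ (b ◁ c) :=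
  Shelf.self_distrib

/-- Needed when the boundary fixes the color to the left of an over-strand and the one to the right
must be recovered. -/
theorem act_left_inj {Q : Type*} [Qualgebra Q] {a a' b : Q} : a ◁ b = a' ◁ b ↔ a = a' :=
  Rack.left_cancel b

/-- The coloring rule at an oriented special point. -/
def SpecialPoint.IsColored {A Q : Type*} [Qualgebra Q] (o : A → Bool) (C : A → Q)
    (p : SpecialPoint A) : Prop :=
  ∀ P ∈ p.orient o, (P.map C).IsColored

/-- The weight of a colored oriented special point. -/
def SpecialPoint.weight {A Q : Type*} [Qualgebra Q] (ω : Pattern Q → ℤ) (o : A → Bool) (C : A → Q)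
    (p : SpecialPoint A) : ℤ :=
  (p.orient o).elim 0 fun P => ω (P.map C)

/-! ### Colorings and weights computed point by point -/

theorem SubDiagram.isColoring_iff {n : ℕ} {Q : Type*} [Qualgebra Q] (D : SubDiagram n)
    (o : Fin n → Bool) (C : Fin n → Q) :
    D.IsColoring o C ↔ ∀ p ∈ D.points, p.IsColored o C := by
  simp only [IsColoring, patterns, SpecialPoint.IsColored, List.mem_filterMap, Option.mem_def]
  exact ⟨fun h p hp P hP => h P ⟨p, hp, hP⟩, fun h P ⟨p, hp, hP⟩ => h p hp P hP⟩

/-- The default weight `0` accounts for the points that `filterMap` drops, so no well-orientedness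
is required. -/
theorem SubDiagram.weight_eq_sum {n : ℕ} {Q : Type*} [Qualgebra Q] (ω : Pattern Q → ℤ)
    (D : SubDiagram n) (o : Fin n → Bool) (C : Fin n → Q) :
    D.weight ω o C = (D.points.map fun p => p.weight ω o C).sum := by
  simp only [SubDiagram.weight, patterns]
  induction D.points with
  | nil => rfl
  | cons p l ih =>
    cases h : p.orient o <;> simp [SpecialPoint.weight, h, ih]

theorem SpecialPoint.isColored_crossing {A Q : Type*} [Qualgebra Q] (o : A → Bool) (C : A → Q)
    (u₀ o₁ u₂ o₃ : ArcEnd A) :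
    (SpecialPoint.crossing u₀ o₁ u₂ o₃).IsColored o C ↔
      match IsHead o u₀, IsHead o o₁, IsHead o u₂, IsHead o o₃ with
      | true, false, false, true => C o₁.1 = C o₃.1 ∧ C u₂.1 = C u₀.1 ◁ C o₃.1
      | false, true, true, false => C o₃.1 = C o₁.1 ∧ C u₀.1 = C u₂.1 ◁ C o₁.1
      | true, true, false, false => C o₃.1 = C o₁.1 ∧ C u₀.1 = C u₂.1 ◁ C o₁.1
      | false, false, true, true => C o₁.1 = C o₃.1 ∧ C u₂.1 = C u₀.1 ◁ C o₃.1
      | _, _, _, _ => True := by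
  simp only [SpecialPoint.IsColored, orient]
  split <;> simp [Pattern.map, Pattern.IsColored]

theorem SpecialPoint.isColored_vertex {A Q : Type*} [Qualgebra Q] (o : A → Bool) (C : A → Q)
    (e₀ e₁ e₂ : ArcEnd A) :
    (SpecialPoint.vertex e₀ e₁ e₂).IsColored o C ↔
      match IsHead o e₀, IsHead o e₁, IsHead o e₂ with
      | false, true, true => C e₀.1 = C e₂.1 ⋄ C e₁.1
      | true, false, true => C e₁.1 = C e₀.1 ⋄ C e₂.1
      | true, true, false => C e₂.1 = C e₁.1 ⋄ C e₀.1
      | true, false, false => C e₀.1 = C e₁.1 ⋄ C e₂.1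
      | false, true, false => C e₁.1 = C e₂.1 ⋄ C e₀.1
      | false, false, true => C e₂.1 = C e₀.1 ⋄ C e₁.1
      | _, _, _ => True := by
  simp only [SpecialPoint.IsColored, orient]
  split <;> simp [Pattern.map, Pattern.IsColored]

theorem SpecialPoint.weight_crossing {A Q : Type*} [Qualgebra Q] (χ lam : Q → Q → ℤ) (o : A → Bool)
    (C : A → Q) (u₀ o₁ u₂ o₃ : ArcEnd A) :
    (SpecialPoint.crossing u₀ o₁ u₂ o₃).weight (pairWeight χ lam) o C =
      match IsHead o u₀, IsHead o o₁, IsHead o u₂, IsHead o o₃ with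
      | true, false, false, true => χ (C u₀.1) (C o₃.1)
      | false, true, true, false => χ (C u₂.1) (C o₁.1)
      | true, true, false, false => -χ (C u₂.1) (C o₁.1)
      | false, false, true, true => -χ (C u₀.1) (C o₃.1)
      | _, _, _, _ => 0 := by
  simp only [SpecialPoint.weight, orient]
  split <;> rfl

theorem SpecialPoint.weight_vertex {A Q : Type*} [Qualgebra Q] (χ lam : Q → Q → ℤ) (o : A → Bool)
    (C : A → Q) (e₀ e₁ e₂ : ArcEnd A) :
    (SpecialPoint.vertex e₀ e₁ e₂).weight (pairWeight χ lam) o C =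
      match IsHead o e₀, IsHead o e₁, IsHead o e₂ with
      | false, true, true => -lam (C e₂.1) (C e₁.1)
      | true, false, true => -lam (C e₀.1) (C e₂.1)
      | true, true, false => -lam (C e₁.1) (C e₀.1)
      | true, false, false => lam (C e₁.1) (C e₂.1)
      | false, true, false => lam (C e₂.1) (C e₀.1)
      | false, false, true => lam (C e₀.1) (C e₁.1)
      | _, _, _ => 0 := by
  simp only [SpecialPoint.weight, orient]
  split <;> rfl

section

variable {Q : Type*} [Qualgebra Q] {χ lam : Q → Q → ℤ}

open SubDiagram

attribute [local simp] WellOriented IsHead SpecialPoint.orient_crossing_isSome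
  SpecialPoint.orient_vertex_isSome boundaryData isColoring_iff weight_eq_sum
  SpecialPoint.isColored_crossing SpecialPoint.isColored_vertex SpecialPoint.weight_crossing
  SpecialPoint.weight_vertex SpecialPoint.mirror SubDiagram.mirror
  kink strand bigon twoStrands triangle triangle' underOneLeg underTwoLegs twistedVertex
  plainVertex overOneLeg overTwoLegs

/-! ### Sufficiency: invariance under each move -/

theorem sameWeight_kink
    (hquandle : ∀ a : Q, χ a a = 0) :
    SameWeight (pairWeight χ lam) kink strand ∧
      SameWeight (pairWeight χ lam) kink.mirror strand.mirror := by
  constructor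
  all_goals
    intro o o' hw hw' C C' hC hC' hb
    simp at hw hw' hb hC hC' ⊢
    -- As free variables, orientations and colors can be eliminated by substitution; one Boolean
    -- survives, the direction of the strand.
    generalize o 0 = o0, o 1 = o1, o 2 = o2 at *
    generalize o' 0 = o0' at *
    generalize C 0 = c0, C 1 = c1, C 2 = c2 at *
    generalize C' 0 = c0' at *
    casesm* _ ∧ _
    subst_vars
    cases ‹Bool› <;> simp at * <;>
      grind [act_left_inj, quandle_fix]

/-- The two crossings have opposite signs and equal color pairs, so they cancel for any `χ`. -/
theorem sameWeight_bigon :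
    SameWeight (pairWeight χ lam) bigon twoStrands ∧
      SameWeight (pairWeight χ lam) bigon.mirror twoStrands.mirror := by
  constructor
  all_goals
    intro o o' hw hw' C C' hC hC' hb
    simp at hw hw' hb hC hC' ⊢
    generalize o 0 = o0, o 1 = o1, o 2 = o2, o 3 = o3, o 4 = o4, o 5 = o5 at *
    generalize o' 0 = o0', o' 1 = o1' at *
    generalize C 0 = c0, C 1 = c1, C 2 = c2, C 3 = c3, C 4 = c4, C 5 = c5 at *
    generalize C' 0 = c0', C' 1 = c1' at *
    casesm* _ ∧ _
    subst_vars
    cases ‹Bool› <;> cases ‹Bool› <;> simp at * <;>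
      casesm* _ ∧ _ <;> subst_vars <;>
      grind [act_left_inj]

/-- The crossing of the two upper strands weighs the same on both sides; the other four crossings
give the cocycle identity, with terms moved across according to their signs. -/
theorem sameWeight_triangle
    (hcocycle : ∀ a b c : Q, χ a b + χ (a ◁ b) c = χ (a ◁ c) (b ◁ c) + χ a c) :
    SameWeight (pairWeight χ lam) triangle triangle' ∧
      SameWeight (pairWeight χ lam) triangle.mirror triangle'.mirror := by
  constructor
  all_goals
    intro o o' hw hw' C C' hC hC' hb
    simp at hw hw' hb hC hC' ⊢
    generalize o 0 = o0, o 1 = o1, o 2 = o2, o 3 = o3, o 4 = o4, o 5 = o5, o 6 = o6, o 7 = o7,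
      o 8 = o8 at *
    generalize o' 0 = o0', o' 1 = o1', o' 2 = o2', o' 3 = o3', o' 4 = o4', o' 5 = o5', o' 6 = o6',
      o' 7 = o7', o' 8 = o8' at *
    generalize C 0 = c0, C 1 = c1, C 2 = c2, C 3 = c3, C 4 = c4, C 5 = c5, C 6 = c6, C 7 = c7,
      C 8 = c8 at *
    generalize C' 0 = c0', C' 1 = c1', C' 2 = c2', C' 3 = c3', C' 4 = c4', C' 5 = c5', C' 6 = c6',
      C' 7 = c7', C' 8 = c8' at *
    casesm* _ ∧ _
    subst_vars
    cases ‹Bool› <;> cases ‹Bool› <;> cases ‹Bool› <;> simp at * <;>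
      casesm* _ ∧ _ <;> subst_vars <;>
      grind [act_left_inj, act_act]

theorem sameWeight_underLegs
    (hunder : ∀ a b c : Q, χ a (b ⋄ c) = χ a b + χ (a ◁ b) c) :
    SameWeight (pairWeight χ lam) underOneLeg underTwoLegs ∧
      SameWeight (pairWeight χ lam) underOneLeg.mirror underTwoLegs.mirror := by
  constructor
  all_goals
    intro o o' hw hw' C C' hC hC' hb
    simp at hw hw' hb hC hC' ⊢
    generalize o 0 = o0, o 1 = o1, o 2 = o2, o 3 = o3, o 4 = o4, o 5 = o5 at *
    generalize o' 0 = o0', o' 1 = o1', o' 2 = o2', o' 3 = o3', o' 4 = o4', o' 5 = o5', o' 6 = o6',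
      o' 7 = o7' at *
    generalize C 0 = c0, C 1 = c1, C 2 = c2, C 3 = c3, C 4 = c4, C 5 = c5 at *
    generalize C' 0 = c0', C' 1 = c1', C' 2 = c2', C' 3 = c3', C' 4 = c4', C' 5 = c5', C' 6 = c6',
      C' 7 = c7' at *
    casesm* _ ∧ _
    subst_vars
    -- One direction for the strand and three for the legs; sources and sinks contradict `hw`.
    cases ‹Bool› <;> cases ‹Bool› <;> cases ‹Bool› <;> cases ‹Bool› <;> simp at * <;>
      casesm* _ ∧ _ <;> subst_vars <;>
      grind [act_left_inj, Qualgebra.comp]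

/-- If the stem is opposite to the crossed legs, `htwist` suffices. If the over-leg is the stem, the
crossing weighs `χ a (a ⋄ d)` up to sign, which `hunder` and `χ a a = 0` reduce to `χ a d`. If the
under-leg is the stem, `χ (b ⋄ d) b` is expanded by `hover`, again with `χ b b = 0`. -/
theorem sameWeight_twistedVertex
    (hquandle : ∀ a : Q, χ a a = 0)
    (hunder : ∀ a b c : Q, χ a (b ⋄ c) = χ a b + χ (a ◁ b) c)
    (hover : ∀ a b c : Q,
      χ (a ⋄ b) c + lam (a ◁ c) (b ◁ c) = χ a c + χ b c + lam a b)
    (htwist : ∀ a b : Q, χ a b + lam a b = lam b (a ◁ b)) :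
    SameWeight (pairWeight χ lam) twistedVertex plainVertex ∧
      SameWeight (pairWeight χ lam) twistedVertex.mirror plainVertex.mirror := by
  constructor
  all_goals
    intro o o' hw hw' C C' hC hC' hb
    simp at hw hw' hb hC hC' ⊢
    generalize o 0 = o0, o 1 = o1, o 2 = o2, o 3 = o3, o 4 = o4 at *
    generalize o' 0 = o0', o' 1 = o1', o' 2 = o2' at *
    generalize C 0 = c0, C 1 = c1, C 2 = c2, C 3 = c3, C 4 = c4 at *
    generalize C' 0 = c0', C' 1 = c1', C' 2 = c2' at *
    casesm* _ ∧ _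
    subst_vars
    cases ‹Bool› <;> cases ‹Bool› <;> cases ‹Bool› <;> simp at * <;>
      casesm* _ ∧ _ <;> subst_vars <;>
      grind [act_left_inj, quandle_fix, act_act, Qualgebra.comp, Qualgebra.distrib,
        Qualgebra.semicomm]

theorem sameWeight_overLegs
    (hover : ∀ a b c : Q,
      χ (a ⋄ b) c + lam (a ◁ c) (b ◁ c) = χ a c + χ b c + lam a b) :
    SameWeight (pairWeight χ lam) overOneLeg overTwoLegs ∧
      SameWeight (pairWeight χ lam) overOneLeg.mirror overTwoLegs.mirror := by
  constructor
  all_goals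
    intro o o' hw hw' C C' hC hC' hb
    simp at hw hw' hb hC hC' ⊢
    generalize o 0 = o0, o 1 = o1, o 2 = o2, o 3 = o3, o 4 = o4, o 5 = o5 at *
    generalize o' 0 = o0', o' 1 = o1', o' 2 = o2', o' 3 = o3', o' 4 = o4', o' 5 = o5', o' 6 = o6',
      o' 7 = o7' at *
    generalize C 0 = c0, C 1 = c1, C 2 = c2, C 3 = c3, C 4 = c4, C 5 = c5 at *
    generalize C' 0 = c0', C' 1 = c1', C' 2 = c2', C' 3 = c3', C' 4 = c4', C' 5 = c5', C' 6 = c6',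
      C' 7 = c7' at *
    casesm* _ ∧ _
    subst_vars
    cases ‹Bool› <;> cases ‹Bool› <;> cases ‹Bool› <;> cases ‹Bool› <;> simp at * <;>
      casesm* _ ∧ _ <;> subst_vars <;>
      grind [act_left_inj, Qualgebra.distrib]

/-- Carrying the mirror image along makes the induction close: reflection is an involution, so the
`mirror` case just swaps the two halves. -/
theorem RMove.sameWeight
    (hcocycle : ∀ a b c : Q, χ a b + χ (a ◁ b) c = χ (a ◁ c) (b ◁ c) + χ a c)
    (hquandle : ∀ a : Q, χ a a = 0)
    (hunder : ∀ a b c : Q, χ a (b ⋄ c) = χ a b + χ (a ◁ b) c)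
    (hover : ∀ a b c : Q,
      χ (a ⋄ b) c + lam (a ◁ c) (b ◁ c) = χ a c + χ b c + lam a b)
    (htwist : ∀ a b : Q, χ a b + lam a b = lam b (a ◁ b))
    {n m : ℕ} {D : SubDiagram n} {D' : SubDiagram m} (h : RMove D D') :
    SameWeight (pairWeight χ lam) D D' ∧
      SameWeight (pairWeight χ lam) D.mirror D'.mirror := by
  induction h with
  | r1 => exact sameWeight_kink hquandle
  | r2 => exact sameWeight_bigon
  | r3 => exact sameWeight_triangle hcocycle
  | r4 => exact sameWeight_underLegs hunder
  | r5 => exact sameWeight_twistedVertex hquandle hunder hover htwist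
  | r6 => exact sameWeight_overLegs hover
  | mirror _ ih => exact ⟨ih.2, by simpa only [SubDiagram.mirror_mirror] using ih.1⟩

/-! ### Necessity: one colored move per identity -/

theorem IsBoltzmann.sameWeight {ω : Pattern Q → ℤ} (H : IsBoltzmann ω) {n m : ℕ}
    {D : SubDiagram n} {D' : SubDiagram m} (h : RMove D D') : SameWeight ω D D' :=
  H n m D D' h

theorem IsBoltzmann.chi_self (H : IsBoltzmann (pairWeight χ lam)) (a : Q) :
    χ a a = 0 := by
  have h := H.sameWeight .r1 (fun _ => true) (fun _ => true) (by simp) (by simp)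
    ![a, a, a]
    ![a]
    (by simp) (by simp) (by simp)
  simp at h
  linarith

theorem IsBoltzmann.cocycle (H : IsBoltzmann (pairWeight χ lam)) (a b c : Q) :
    χ a b + χ (a ◁ b) c = χ (a ◁ c) (b ◁ c) + χ a c := by
  have h := H.sameWeight .r3 (fun _ => true) (fun _ => true) (by simp) (by simp)
    -- The colors `a`, `b`, `c` enter at the top of the lowest, middle and highest strand;
    -- self-distributivity makes the lower ends agree.
    ![a, a ◁ b, (a ◁ b) ◁ c, b, b, b ◁ c, c, c, c]
    ![a, a ◁ c, (a ◁ c) ◁ (b ◁ c), b, b ◁ c, b ◁ c, c, c, c]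
    (by simp) (by simp [← act_act]) (by simp [← act_act])
  simp at h
  linarith

theorem IsBoltzmann.chi_dia_right (H : IsBoltzmann (pairWeight χ lam)) (a b c : Q) :
    χ a (b ⋄ c) = χ a b + χ (a ◁ b) c := by
  have h := H.sameWeight .r4 (fun _ => true) (fun _ => true) (by simp) (by simp)
    -- Both vertices are zips with upper colors `b`, `c`, so their weights cancel.
    ![a, a ◁ (b ⋄ c), b, c, b ⋄ c, b ⋄ c]
    ![a, a ◁ b, (a ◁ b) ◁ c, b, b, c, c, b ⋄ c]
    (by simp [Qualgebra.comp]) (by simp) (by simp [Qualgebra.comp])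
  simp at h
  linarith

theorem IsBoltzmann.chi_dia_left (H : IsBoltzmann (pairWeight χ lam)) (a b c : Q) :
    χ (a ⋄ b) c + lam (a ◁ c) (b ◁ c) = χ a c + χ b c + lam a b := by
  have h := H.sameWeight .r6 (fun _ => true) (fun _ => true) (by simp) (by simp)
    ![c, c, a, b, a ⋄ b, (a ⋄ b) ◁ c]
    ![c, c, c, b, b ◁ c, a, a ◁ c, (a ◁ c) ⋄ (b ◁ c)]
    (by simp [Qualgebra.distrib]) (by simp) (by simp [Qualgebra.distrib])
  simp at h
  linarith

theorem IsBoltzmann.chi_add_lam (H : IsBoltzmann (pairWeight χ lam)) (a b : Q) :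
    χ a b + lam a b = lam b (a ◁ b) := by
  have h := H.sameWeight .r5 (fun _ => true) (fun _ => true) (by simp) (by simp)
    -- Semi-commutativity is what makes the two stems agree.
    ![a, a ◁ b, b, b, b ⋄ (a ◁ b)]
    ![a, b, a ⋄ b]
    (by simp) (by simp) (by simp [← Qualgebra.semicomm])
  simp at h
  linarith

end

end KnottedGraph

/-- The weight function `(χ, lam)` on qualgebra-colored well-oriented graph diagrams is Boltzmann if
and only if `χ` is a quandle `2`-cocycle and the three additional relations hold. -/
theorem propositionP {Q : Type*} [Qualgebra Q] (χ lam : Q → Q → ℤ) :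
    KnottedGraph.IsBoltzmann (KnottedGraph.pairWeight χ lam) ↔
      (∀ a b c : Q, χ a b + χ (a ◁ b) c = χ (a ◁ c) (b ◁ c) + χ a c) ∧
      (∀ a : Q, χ a a = 0) ∧
      (∀ a b c : Q, χ a (b ⋄ c) = χ a b + χ (a ◁ b) c) ∧
      (∀ a b c : Q, χ (a ⋄ b) c + lam (a ◁ c) (b ◁ c) = χ a c + χ b c + lam a b) ∧
      (∀ a b : Q, χ a b + lam a b = lam b (a ◁ b)) := by
  exact ⟨fun H => ⟨H.cocycle, H.chi_self, H.chi_dia_right, H.chi_dia_left, H.chi_add_lam⟩,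
    fun ⟨h₁, h₂, h₃, h₄, h₅⟩ _ _ _ _ h => (h.sameWeight h₁ h₂ h₃ h₄ h₅).1⟩
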